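/- Let $\mathcal C$ be a category with finite colimits, regarded as a symmetric monoidal category $(\mathcal C,+)$ with tensor product the coproduct and unit the initial object $\varnothing$; let $(\mathcal D,\otimes,1)$ be a braided monoidal category; and let $(F,\varphi)\colon(\mathcal C,+)\to(\mathcal D,\otimes)$ be a lax braided monoidal functor. Definitions. A *hypergraph category* is a symmetric monoidal category in which every object $X$ is equipped with a special commutative Frobenius monoid $(\mu_X,\eta_X,\delta_X,\epsilon_X)$ such that (suppressing associators and unitors) $\mu_{X\otimes Y}=(\mu_X\otimes\mu_Y)\circ(1_X\otimes\sigma_{Y,X}\otimes 1_Y)$, $\eta_{X\otimes Y}=\eta_X\otimes\eta_Y$, $\delta_{X\otimes Y}=(1_X\otimes\sigma_{X,Y}\otimes 1_Y)\circ(\delta_X\otimes\delta_Y)$ and $\epsilon_{X\otimes Y}=\epsilon_X\otimes\epsilon_Y$. A *hypergraph functor* is a strong symmetric monoidal functor $(G,\gamma)$ such that the Frobenius monoid on $GX$ is $(G\mu_X\circ\gamma_{X,X},\ G\eta_X\circ\gamma_1,\ \gamma_{X,X}^{-1}\circ G\delta_X,\ \gamma_1^{-1}\circ G\epsilon_X)$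 for every $X$. A *wide embedding* is a faithful functor that is bijective on objects. $\mathrm{Cospan}(\mathcal C)$ is the category with the objects of $\mathcal C$ and with isomorphism classes of cospans $X\to N\leftarrow Y$ as morphisms, composed by pushout. It is a hypergraph category: its monoidal product is the coproduct of objects and of cospans, its coherence maps and symmetry are those of $(\mathcal C,+)$, where $f\colon X\to Y$ is viewed as the cospan $X\xrightarrow{f}Y\xleftarrow{1}Y$, and the Frobenius monoid on $X$ consists of $[1_X,1_X]\colon X+X\to X$ and $!\colon\varnothing\to X$, viewed as cospans, together with the opposite cospans. $F\mathrm{Cospan}$ is the category with the objects of $\mathcal C$ and with isomorphism classes of $F$-decorated cospans as morphisms. An $F$-decorated cospan is a cospan $X\to N\leftarrow Y$ in $\mathcal C$ together with a morphism $s\colon 1\to FN$ (the decoration); isomorphisms of decorated cospans are isomorphisms $n\colon N\to N'$ of cospans with $Fn\circ s=s'$. The composite of $(X\to N\leftarrow Y,\,s)$ and $(Y\to M\leftarrow Z,\,t)$ is the pushout cospan with apex $N+_YM$ decorated by $$1\xrightarrow{\lambda^{-1}}1\otimes1\xrightarrow{s\otimes t}FN\otimes FM\xrightarrow{\varphi_{N,M}}F(N+M)\xrightarrow{F[j_N,j_M]}F(N+_YM),$$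 where $j_N,j_M$ are the pushout maps. The *empty decoration* on $N$ is $1\xrightarrow{\varphi_1}F\varnothing\xrightarrow{F!}FN$, and the identity morphisms are the identity cospans with the empty decoration. Let $E\colon\mathrm{Cospan}(\mathcal C)\to F\mathrm{Cospan}$ be the functor that is the identity on objects and sends each cospan to the same cospan with the empty decoration. **Theorem.** $F\mathrm{Cospan}$ carries a symmetric monoidal structure and a hypergraph structure (in particular a special commutative Frobenius monoid on each object) for which $E\colon\mathrm{Cospan}(\mathcal C)\hookrightarrow F\mathrm{Cospan}$ is a wide embedding and a hypergraph functor. Moreover these structures can be chosen so that $E$ is strict monoidal and so that the monoidal product of the morphisms represented by $(X\to N\leftarrow Y,\,s)$ and $(X'\to N'\leftarrow Y',\,t)$ is represented by the cospan $X+X'\to N+N'\leftarrow Y+Y'$ with decoration $$1\xrightarrow{\lambda^{-1}}1\otimes1\xrightarrow{s\otimes t}FN\otimes FN'\xrightarrow{\varphi_{N,N'}}F(N+N').$$ -/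

import Mathlib

open CategoryTheory CategoryTheory.Limits MonoidalCategory

universe v₁ v₂ u₁ u₂

-- A category with finite colimits is regarded as the symmetric monoidal category `(C, +)`:
-- the tensor product is the binary coproduct and the unit is the initial object.
attribute [local instance] monoidalOfHasFiniteCoproducts symmetricOfHasFiniteCoproducts

noncomputable section

section Hypergraph

variable {C : Type u₁} [Category.{v₁} C] [MonoidalCategory C] [SymmetricCategory C]

/-- A special commutative Frobenius monoid structure on an object of a symmetric monoidal
category. -/
structure SpecialCommFrobenius (X : C) extends MonObj X, ComonObj X where
  frobenius_left : comul ▷ X ≫ (α_ X X X).hom ≫ X ◁ mul = mul ≫ comul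
  frobenius_right : X ◁ comul ≫ (α_ X X X).inv ≫ mul ▷ X = mul ≫ comul
  special : comul ≫ mul = 𝟙 X
  mul_comm : (β_ X X).hom ≫ mul = mul
  comul_comm : comul ≫ (β_ X X).hom = comul

variable (C) in
/-- A hypergraph category: a symmetric monoidal category in which every object is equipped with a
special commutative Frobenius monoid, compatibly with the tensor product.  Here
`tensorμ X Y Z W : (X ⊗ Y) ⊗ (Z ⊗ W) ⟶ (X ⊗ Z) ⊗ (Y ⊗ W)` braids the two middle factors. -/
class HypergraphCategory where
  frob : ∀ X : C, SpecialCommFrobenius X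
  mul_tensor : ∀ X Y : C,
    (frob (X ⊗ Y)).mul = tensorμ X Y X Y ≫ ((frob X).mul ⊗ₘ (frob Y).mul)
  one_tensor : ∀ X Y : C,
    (frob (X ⊗ Y)).one = (λ_ (𝟙_ C)).inv ≫ ((frob X).one ⊗ₘ (frob Y).one)
  comul_tensor : ∀ X Y : C,
    (frob (X ⊗ Y)).comul = ((frob X).comul ⊗ₘ (frob Y).comul) ≫ tensorμ X X Y Y
  counit_tensor : ∀ X Y : C,
    (frob (X ⊗ Y)).counit = ((frob X).counit ⊗ₘ (frob Y).counit) ≫ (λ_ (𝟙_ C)).hom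

variable {D : Type u₂} [Category.{v₂} D] [MonoidalCategory D] [SymmetricCategory D]

open Functor.LaxMonoidal Functor.OplaxMonoidal HypergraphCategory in
/-- A strong symmetric monoidal functor between hypergraph categories is a hypergraph functor if
it carries the chosen Frobenius structure of `X` to that of `G.obj X`.  (`δ` and `η` are the
inverses of the coherence isomorphisms `μ` and `ε` of `G`.) -/
structure IsHypergraphFunctor [HypergraphCategory C] [HypergraphCategory D]
    (G : C ⥤ D) [G.Braided] : Prop where
  map_mul : ∀ X : C, (frob (G.obj X)).mul = μ G X X ≫ G.map (frob X).mul
  map_comul : ∀ X : C, (frob (G.obj X)).comul = G.map (frob X).comul ≫ δ G X X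
  map_one : ∀ X : C, (frob (G.obj X)).one = ε G ≫ G.map (frob X).one
  map_counit : ∀ X : C, (frob (G.obj X)).counit = G.map (frob X).counit ≫ η G

end Hypergraph

/-- A wide embedding: a faithful functor that is bijective on objects. -/
structure IsWideEmbedding {C : Type u₁} [Category.{v₁} C] {D : Type u₂} [Category.{v₂} D]
    (G : C ⥤ D) : Prop where
  faithful : G.Faithful
  bijective_obj : Function.Bijective G.obj

section Cospans

variable {C : Type u₁} [Category.{v₁} C]

/-- A cospan `X ⟶ apex ⟵ Y`. -/
structure Cospan (X Y : C) where
  apex : C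
  left : X ⟶ apex
  right : Y ⟶ apex

namespace Cospan

/-- Two cospans are isomorphic if there is an isomorphism of apices compatible with the legs. -/
def setoid (X Y : C) : Setoid (Cospan X Y) where
  r a b := ∃ e : a.apex ≅ b.apex, a.left ≫ e.hom = b.left ∧ a.right ≫ e.hom = b.right
  iseqv :=
    { refl := fun a => ⟨Iso.refl _, by simp, by simp⟩
      symm := fun ⟨e, h₁, h₂⟩ => ⟨e.symm, by simp [← h₁], by simp [← h₂]⟩
      trans := fun ⟨e, h₁, h₂⟩ ⟨f, h₃, h₄⟩ =>
        ⟨e ≪≫ f, by simp [reassoc_of% h₁, h₃], by simp [reassoc_of% h₂, h₄]⟩ }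

/-- The identity cospan. -/
@[simps]
def id (X : C) : Cospan X X := ⟨X, 𝟙 X, 𝟙 X⟩

/-- Composition of cospans by pushout over the common foot. -/
@[simps]
def comp [HasPushouts C] {X Y Z : C} (a : Cospan X Y) (b : Cospan Y Z) : Cospan X Z :=
  ⟨pushout a.right b.left, a.left ≫ pushout.inl _ _, b.right ≫ pushout.inr _ _⟩

/-- The opposite (reflected) cospan. -/
@[simps]
def opposite {X Y : C} (a : Cospan X Y) : Cospan Y X := ⟨a.apex, a.right, a.left⟩

/-- A morphism `f : X ⟶ Y` viewed as the cospan `X ⟶ Y ⟵ Y` with right leg the identity. -/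
@[simps]
def ofHom {X Y : C} (f : X ⟶ Y) : Cospan X Y := ⟨Y, f, 𝟙 Y⟩

/-- The coproduct of two cospans. -/
@[simps]
def sum [HasBinaryCoproducts C] {X Y X' Y' : C} (a : Cospan X Y) (b : Cospan X' Y') :
    Cospan (X ⨿ X') (Y ⨿ Y') :=
  ⟨a.apex ⨿ b.apex, coprod.map a.left b.left, coprod.map a.right b.right⟩

end Cospan

variable (C) in
/-- The category `Cospan(C)`: its objects are those of `C` and its morphisms are isomorphism
classes of cospans in `C`. -/
structure CospanCat where
  of ::
  as : C

namespace CospanCat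

/-- Isomorphism classes of cospans. -/
def Hom (X Y : CospanCat C) : Type (max u₁ v₁) := Quotient (Cospan.setoid X.as Y.as)

instance : Quiver (CospanCat C) := ⟨Hom⟩

/-- The isomorphism class of a cospan. -/
def mk {X Y : C} (a : Cospan X Y) : of X ⟶ of Y := Quotient.mk _ a

lemma mk_eq {X Y N M : C} {l : X ⟶ N} {r : Y ⟶ N} {l' : X ⟶ M} {r' : Y ⟶ M} (e : N ≅ M)
    (h₁ : l ≫ e.hom = l') (h₂ : r ≫ e.hom = r') : mk ⟨N, l, r⟩ = mk ⟨M, l', r'⟩ :=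
  Quotient.sound ⟨e, h₁, h₂⟩

lemma mk_congr {X Y N : C} {l l' : X ⟶ N} {r r' : Y ⟶ N}
    (h₁ : l = l') (h₂ : r = r') : mk ⟨N, l, r⟩ = mk ⟨N, l', r'⟩ := by rw [h₁, h₂]

lemma exists_rep {X Y : CospanCat C} (f : X ⟶ Y) :
    ∃ (N : C) (l : X.as ⟶ N) (r : Y.as ⟶ N), f = mk ⟨N, l, r⟩ := by
  obtain ⟨⟨N, l, r⟩, h⟩ := Quotient.exists_rep f
  exact ⟨N, l, r, h.symm⟩

variable [HasFiniteColimits C]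

lemma comp_aux {X Y Z : C} {a a' : Cospan X Y} {b b' : Cospan Y Z}
    (h : (Cospan.setoid X Y).r a a') (h' : (Cospan.setoid Y Z).r b b') :
    (Cospan.setoid X Z).r (a.comp b) (a'.comp b') := by
  obtain ⟨e, h₁, h₂⟩ := h
  obtain ⟨f, h₃, h₄⟩ := h'
  have p := (IsPushout.of_hasPushout a.right b.left).of_iso (f' := a'.right) (g' := b'.left)
    (inl' := e.inv ≫ pushout.inl _ _) (inr' := f.inv ≫ pushout.inr _ _) (Iso.refl _) e f
    (Iso.refl _) (by simp [h₂]) (by simp [h₃]) (by simp) (by simp)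
  refine ⟨p.isoPushout, ?_, ?_⟩
  · have := p.inl_isoPushout_hom
    simp only [Category.assoc] at this
    simp only [Cospan.comp, Category.assoc, ← h₁, ← this, Iso.hom_inv_id_assoc]
  · have := p.inr_isoPushout_hom
    simp only [Category.assoc] at this
    simp only [Cospan.comp, Category.assoc, ← h₄, ← this, Iso.hom_inv_id_assoc]

instance : CategoryStruct (CospanCat C) where
  id X := mk (Cospan.id X.as)
  comp f g := Quotient.map₂ Cospan.comp (fun _ _ h _ _ h' => comp_aux h h') f g

/-- The composite may be computed by any pushout. -/
lemma comp_eq {X Y Z N M P : C} {l : X ⟶ N} {r : Y ⟶ N} {l' : Y ⟶ M} {r' : Z ⟶ M}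
    {j : N ⟶ P} {k : M ⟶ P} (h : IsPushout r l' j k) :
    mk ⟨N, l, r⟩ ≫ mk ⟨M, l', r'⟩ = mk ⟨P, l ≫ j, r' ≫ k⟩ :=
  mk_eq h.isoPushout.symm (by simp) (by simp)

instance : Category (CospanCat C) where
  id_comp {X Y} f := by
    obtain ⟨N, l, r, rfl⟩ := exists_rep f
    exact (comp_eq (IsPushout.id_horiz l)).trans (mk_congr (by simp) (by simp))
  comp_id {X Y} f := by
    obtain ⟨N, l, r, rfl⟩ := exists_rep f
    exact (comp_eq (IsPushout.id_vert r)).trans (mk_congr (by simp) (by simp))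
  assoc {X Y Z W} f g h := by
    obtain ⟨N, l, r, rfl⟩ := exists_rep f
    obtain ⟨M, l', r', rfl⟩ := exists_rep g
    obtain ⟨P, l'', r'', rfl⟩ := exists_rep h
    have p := IsPushout.of_hasPushout r l'
    have q := IsPushout.of_hasPushout r' l''
    have s := IsPushout.of_hasPushout (pushout.inr r l') (pushout.inl r' l'')
    exact ((comp_eq (q.paste_horiz s)).trans
      (mk_congr (Category.assoc _ _ _) (Category.assoc _ _ _).symm)).trans
      (comp_eq (p.paste_vert s)).symm

/-- The identity-on-objects functor `C ⥤ Cospan(C)` viewing a morphism as a cospan. -/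
@[simps! obj map]
def incl : C ⥤ CospanCat C where
  obj X := of X
  map f := mk (Cospan.ofHom f)
  map_id X := rfl
  map_comp {X Y Z} f g :=
    ((comp_eq (IsPushout.id_horiz g)).trans (mk_congr rfl (by simp))).symm

/-- A pushout of coproducts is the coproduct of the pushouts. -/
lemma isPushout_coprodMap {Y N M P Y' N' M' P' : C}
    {r : Y ⟶ N} {l : Y ⟶ M} {j : N ⟶ P} {k : M ⟶ P} (h : IsPushout r l j k)
    {r' : Y' ⟶ N'} {l' : Y' ⟶ M'} {j' : N' ⟶ P'} {k' : M' ⟶ P'} (h' : IsPushout r' l' j' k') :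
    IsPushout (coprod.map r r') (coprod.map l l') (coprod.map j j') (coprod.map k k') := by
  have w : coprod.map r r' ≫ coprod.map j j' = coprod.map l l' ≫ coprod.map k k' := by
    simp [h.w, h'.w]
  have w₁ : ∀ s : PushoutCocone (coprod.map r r') (coprod.map l l'),
      r ≫ coprod.inl ≫ s.inl = l ≫ coprod.inl ≫ s.inr := fun s => by
    simpa using coprod.inl ≫= s.condition
  have w₂ : ∀ s : PushoutCocone (coprod.map r r') (coprod.map l l'),
      r' ≫ coprod.inr ≫ s.inl = l' ≫ coprod.inr ≫ s.inr := fun s => by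
    simpa using coprod.inr ≫= s.condition
  refine ⟨⟨w⟩, ⟨PushoutCocone.IsColimit.mk w
    (fun s => coprod.desc (h.desc _ _ (w₁ s)) (h'.desc _ _ (w₂ s)))
    (fun s => ?_) (fun s => ?_) (fun s m h₁ h₂ => ?_)⟩⟩
  · rw [coprod.map_desc, h.inl_desc, h'.inl_desc]
    exact coprod.hom_ext (coprod.inl_desc _ _) (coprod.inr_desc _ _)
  · rw [coprod.map_desc, h.inr_desc, h'.inr_desc]
    exact coprod.hom_ext (coprod.inl_desc _ _) (coprod.inr_desc _ _)
  · refine coprod.hom_ext ((h.hom_ext ?_ ?_).trans (coprod.inl_desc _ _).symm)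
      ((h'.hom_ext ?_ ?_).trans (coprod.inr_desc _ _).symm)
    · rw [h.inl_desc, ← h₁, coprod.inl_map_assoc]
    · rw [h.inr_desc, ← h₂, coprod.inl_map_assoc]
    · rw [h'.inl_desc, ← h₁, coprod.inr_map_assoc]
    · rw [h'.inr_desc, ← h₂, coprod.inr_map_assoc]

section Monoidal

lemma sum_aux {X Y X' Y' : C} {a b : Cospan X Y} {a' b' : Cospan X' Y'}
    (h : (Cospan.setoid X Y).r a b) (h' : (Cospan.setoid X' Y').r a' b') :
    (Cospan.setoid (X ⨿ X') (Y ⨿ Y')).r (a.sum a') (b.sum b') := by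
  obtain ⟨e, h₁, h₂⟩ := h
  obtain ⟨e', h₃, h₄⟩ := h'
  refine ⟨coprod.mapIso e e', ?_, ?_⟩
  · simp only [Cospan.sum, coprod.mapIso_hom, coprod.map_map, h₁, h₃]
  · simp only [Cospan.sum, coprod.mapIso_hom, coprod.map_map, h₂, h₄]

/-- The coproduct of two morphisms of `Cospan(C)`. -/
def sum {X Y X' Y' : CospanCat C} (f : X ⟶ Y) (g : X' ⟶ Y') :
    of (X.as ⨿ X'.as) ⟶ of (Y.as ⨿ Y'.as) :=
  Quotient.map₂ Cospan.sum (fun _ _ h _ _ h' => sum_aux h h') f g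

lemma sum_incl {X Y X' Y' : C} (f : X ⟶ Y) (g : X' ⟶ Y') :
    sum (incl.map f) (incl.map g) = incl.map (f ⊗ₘ g) :=
  mk_congr rfl coprod.map_id_id

/-- A morphism `f : X ⟶ Y` viewed as the cospan `Y ⟶ Y ⟵ X` with left leg the identity. -/
def opp {X Y : C} (f : X ⟶ Y) : of Y ⟶ of X := mk (Cospan.ofHom f).opposite

lemma incl_comp {X Y Z N : C} (f : X ⟶ Y) (l : Y ⟶ N) (r : Z ⟶ N) :
    incl.map f ≫ mk ⟨N, l, r⟩ = mk ⟨N, f ≫ l, r⟩ :=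
  (comp_eq (IsPushout.id_horiz l)).trans (mk_congr rfl (by simp))

lemma comp_opp {X Y Z N : C} (f : Z ⟶ Y) (l : X ⟶ N) (r : Y ⟶ N) :
    mk ⟨N, l, r⟩ ≫ opp f = mk ⟨N, l, f ≫ r⟩ :=
  (comp_eq (IsPushout.id_vert r)).trans (mk_congr (by simp) rfl)

lemma opp_comp {X Y Z : C} (f : X ⟶ Y) (g : Y ⟶ Z) : opp (f ≫ g) = opp g ≫ opp f :=
  ((comp_opp f (𝟙 Z) g)).symm

lemma incl_eq_opp {X Y : C} (e : X ≅ Y) : incl.map e.hom = opp e.inv :=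
  mk_eq e.symm e.hom_inv_id (Category.id_comp _)

lemma comp_incl_iso {X Y Z N : C} (e : Y ≅ Z) (l : X ⟶ N) (r : Y ⟶ N) :
    mk ⟨N, l, r⟩ ≫ incl.map e.hom = mk ⟨N, l, e.inv ≫ r⟩ :=
  (congrArg (mk ⟨N, l, r⟩ ≫ ·) (incl_eq_opp e)).trans (comp_opp _ _ _)

/-- The symmetric monoidal structure on `Cospan(C)` inherited from `(C, +)`. -/
instance : MonoidalCategory (CospanCat C) :=
  letI : MonoidalCategoryStruct (CospanCat C) :=
    { tensorObj X Y := of (X.as ⨿ Y.as)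
      tensorUnit := of (⊥_ C)
      tensorHom f g := sum f g
      whiskerLeft X _ _ g := sum (𝟙 X) g
      whiskerRight f X := sum f (𝟙 X)
      associator X Y Z := incl.mapIso (α_ X.as Y.as Z.as)
      leftUnitor X := incl.mapIso (λ_ X.as)
      rightUnitor X := incl.mapIso (ρ_ X.as) }
  .ofTensorHom
    (id_tensorHom_id := fun X Y => by
      refine (sum_incl (𝟙 X.as) (𝟙 Y.as)).trans ?_
      rw [id_tensorHom_id]; rfl)
    (id_tensorHom := fun _ _ _ _ => rfl)
    (tensorHom_id := fun _ _ => rfl)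
    (tensorHom_comp_tensorHom := fun f₁ f₂ g₁ g₂ => by
      obtain ⟨N, l, r, rfl⟩ := exists_rep f₁
      obtain ⟨M, l', r', rfl⟩ := exists_rep f₂
      obtain ⟨P, i, o, rfl⟩ := exists_rep g₁
      obtain ⟨Q, i', o', rfl⟩ := exists_rep g₂
      have p := IsPushout.of_hasPushout r i
      have q := IsPushout.of_hasPushout r' i'
      refine (comp_eq (isPushout_coprodMap p q)).trans ?_
      rw [comp_eq p, comp_eq q]
      exact mk_congr (by simp) (by simp))
    (associator_naturality := fun f g h => by
      obtain ⟨N, l, r, rfl⟩ := exists_rep f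
      obtain ⟨M, l', r', rfl⟩ := exists_rep g
      obtain ⟨P, l'', r'', rfl⟩ := exists_rep h
      refine (comp_incl_iso (α_ _ _ _) _ _).trans ?_
      refine Eq.trans ?_ (incl_comp _ _ _).symm
      refine mk_eq (α_ N M P) (associator_naturality _ _ _) ?_
      rw [Category.assoc, Iso.inv_comp_eq]
      exact associator_naturality _ _ _)
    (leftUnitor_naturality := fun f => by
      obtain ⟨N, l, r, rfl⟩ := exists_rep f
      refine (comp_incl_iso (λ_ _) _ _).trans ?_
      refine Eq.trans ?_ (incl_comp _ _ _).symm
      refine mk_eq (λ_ N) (leftUnitor_naturality _) ?_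
      rw [Category.assoc, Iso.inv_comp_eq]
      exact leftUnitor_naturality _)
    (rightUnitor_naturality := fun f => by
      obtain ⟨N, l, r, rfl⟩ := exists_rep f
      refine (comp_incl_iso (ρ_ _) _ _).trans ?_
      refine Eq.trans ?_ (incl_comp _ _ _).symm
      refine mk_eq (ρ_ N) (rightUnitor_naturality _) ?_
      rw [Category.assoc, Iso.inv_comp_eq]
      exact rightUnitor_naturality _)
    (pentagon := fun X Y Z W =>
      (congrArg₂ (· ≫ ·) (sum_incl (α_ X.as Y.as Z.as).hom (𝟙 W.as))
        ((congrArg _ (sum_incl (𝟙 X.as) (α_ Y.as Z.as W.as).hom)).trans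
          (incl.map_comp _ _).symm)).trans
        ((incl.map_comp _ _).symm.trans
          ((congrArg incl.map (by
            simp only [id_tensorHom, tensorHom_id]; exact pentagon _ _ _ _)).trans
            (incl.map_comp (α_ (X.as ⊗ Y.as) Z.as W.as).hom
              (α_ X.as Y.as (Z.as ⊗ W.as)).hom))))
    (triangle := fun X Y =>
      (congrArg _ (sum_incl (𝟙 X.as) (λ_ Y.as).hom)).trans
        (((incl.map_comp _ _).symm.trans
          (congrArg incl.map (by
            simp only [id_tensorHom, tensorHom_id]; exact triangle _ _))).trans
            (sum_incl (ρ_ X.as).hom (𝟙 Y.as)).symm))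

/-- The symmetry of `Cospan(C)` is that of `(C, +)`. -/
instance : SymmetricCategory (CospanCat C) where
  braiding X Y := incl.mapIso (β_ X.as Y.as)
  braiding_naturality_right X Y Z f := by
    obtain ⟨N, l, r, rfl⟩ := exists_rep f
    refine (comp_incl_iso (β_ _ _) _ _).trans ?_
    refine Eq.trans ?_ (incl_comp _ _ _).symm
    refine mk_eq (β_ _ N) (BraidedCategory.braiding_naturality_right _ _) ?_
    rw [Category.assoc, Iso.inv_comp_eq]
    exact BraidedCategory.braiding_naturality_right _ _
  braiding_naturality_left f Z := by
    obtain ⟨N, l, r, rfl⟩ := exists_rep f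
    refine (comp_incl_iso (β_ _ _) _ _).trans ?_
    refine Eq.trans ?_ (incl_comp _ _ _).symm
    refine mk_eq (β_ N _) (BraidedCategory.braiding_naturality_left _ _) ?_
    rw [Category.assoc, Iso.inv_comp_eq]
    exact BraidedCategory.braiding_naturality_left _ _
  hexagon_forward X Y Z :=
    ((congrArg _ (incl.map_comp _ _).symm).trans (incl.map_comp _ _).symm).trans
      ((congrArg incl.map (by
        simp only [id_tensorHom, tensorHom_id]
        exact BraidedCategory.hexagon_forward _ _ _)).trans
        (((incl.map_comp _ _).trans (congrArg _ (incl.map_comp _ _))).trans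
          (congrArg₂ (· ≫ ·) (sum_incl (β_ X.as Y.as).hom (𝟙 Z.as)).symm
            (congrArg _ (sum_incl (𝟙 Y.as) (β_ X.as Z.as).hom).symm))))
  hexagon_reverse X Y Z :=
    ((congrArg _ (incl.map_comp _ _).symm).trans (incl.map_comp _ _).symm).trans
      ((congrArg incl.map (by
        simp only [id_tensorHom, tensorHom_id]
        exact BraidedCategory.hexagon_reverse _ _ _)).trans
        (((incl.map_comp _ _).trans (congrArg _ (incl.map_comp _ _))).trans
          (congrArg₂ (· ≫ ·) (sum_incl (𝟙 X.as) (β_ Y.as Z.as).hom).symm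
            (congrArg _ (sum_incl (β_ X.as Z.as).hom (𝟙 Y.as)).symm))))
  symmetry X Y := ((incl.map_comp _ _).symm.trans
    (congrArg incl.map (SymmetricCategory.symmetry X.as Y.as))).trans (incl.map_id _)

attribute [local simp] coprod.inl_desc coprod.inr_desc coprod.inl_desc_assoc coprod.inr_desc_assoc

/-- The fold map `[1, 1] : X + X ⟶ X`. -/
abbrev fold (X : C) : X ⨿ X ⟶ X := coprod.desc (𝟙 X) (𝟙 X)

lemma sum_opp {X Y X' Y' : C} (f : X ⟶ Y) (g : X' ⟶ Y') :
    sum (opp f) (opp g) = opp (f ⊗ₘ g) :=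
  mk_congr coprod.map_id_id rfl

lemma opp_comp_incl {X Y Z P : C} {f : X ⟶ Y} {g : X ⟶ Z} {j : Y ⟶ P} {k : Z ⟶ P}
    (h : IsPushout f g j k) : opp f ≫ incl.map g = mk ⟨P, j, k⟩ :=
  (comp_eq h).trans (mk_congr (Category.id_comp _) (Category.id_comp _))

lemma incl_comp_opp {X Y Z : C} (f : X ⟶ Z) (g : Y ⟶ Z) :
    incl.map f ≫ opp g = mk ⟨Z, f, g⟩ :=
  (comp_opp g f (𝟙 Z)).trans (mk_congr rfl (Category.comp_id _))

lemma fold_unit (X : C) : (initial.to X ⊗ₘ 𝟙 X) ≫ fold X = (λ_ X).hom := by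
  simp [fold]

lemma fold_unit' (X : C) : (𝟙 X ⊗ₘ initial.to X) ≫ fold X = (ρ_ X).hom := by
  simp [fold]

lemma fold_assoc (X : C) : coprod.map (fold X) (𝟙 X) ≫ fold X =
    (coprod.associator X X X).hom ≫ coprod.map (𝟙 X) (fold X) ≫ fold X := by
  ext <;> simp

lemma fold_comm (X : C) : (coprod.braiding X X).hom ≫ fold X = fold X := by
  ext <;> simp

lemma fold_tensor (X Y : C) :
    fold (X ⨿ Y) = tensorμ X Y X Y ≫ coprod.map (fold X) (fold Y) := by
  change fold (X ⨿ Y) = ((coprod.associator X Y (X ⨿ Y)).hom ≫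
    coprod.map (𝟙 X) (coprod.associator Y X Y).inv ≫
    coprod.map (𝟙 X) (coprod.map (coprod.braiding Y X).hom (𝟙 Y)) ≫
    coprod.map (𝟙 X) (coprod.associator X Y Y).hom ≫
    (coprod.associator X X (Y ⨿ Y)).inv) ≫ coprod.map (fold X) (fold Y)
  ext <;> simp

lemma fold_tensor' (X Y : C) :
    fold (X ⨿ Y) = tensorδ X X Y Y ≫ coprod.map (fold X) (fold Y) := by
  change fold (X ⨿ Y) = ((coprod.associator X Y (X ⨿ Y)).hom ≫
    coprod.map (𝟙 X) (coprod.associator Y X Y).inv ≫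
    coprod.map (𝟙 X) (coprod.map (coprod.braiding X Y).inv (𝟙 Y)) ≫
    coprod.map (𝟙 X) (coprod.associator X Y Y).hom ≫
    (coprod.associator X X (Y ⨿ Y)).inv) ≫ coprod.map (fold X) (fold Y)
  ext <;> simp

lemma isPushout_fold (X : C) : IsPushout (fold X) (fold X) (𝟙 X) (𝟙 X) :=
  have : Epi (fold X) := epi_of_epi_fac (coprod.inl_desc (𝟙 X) (𝟙 X))
  IsPushout.of_horiz_isIso_epi ⟨rfl⟩

lemma isPushout_frobenius_left (X : C) :
    IsPushout (coprod.map (fold X) (𝟙 X))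
      ((coprod.associator X X X).hom ≫ coprod.map (𝟙 X) (fold X)) (fold X) (fold X) := by
  have w := (fold_assoc X).trans (Category.assoc _ _ _).symm
  refine ⟨⟨w⟩, ⟨PushoutCocone.IsColimit.mk w (fun s => coprod.inl ≫ s.inl)
    (fun s => ?_) (fun s => ?_) (fun s m h₁ h₂ => ?_)⟩⟩
  · have h := s.condition
    have h₁ : coprod.inl ≫ s.inl = coprod.inl ≫ s.inr := by
      simpa using (coprod.inl ≫ coprod.inl) ≫= h
    have h₂ : coprod.inl ≫ s.inl = coprod.inr ≫ s.inr := by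
      simpa using (coprod.inr ≫ coprod.inl) ≫= h
    have h₃ : coprod.inr ≫ s.inl = coprod.inr ≫ s.inr := by
      simpa using coprod.inr ≫= h
    refine coprod.hom_ext ?_ ?_
    · rw [coprod.inl_desc_assoc, Category.id_comp]
    · rw [coprod.inr_desc_assoc, Category.id_comp, h₂, h₃]
  · have h := s.condition
    have h₁ : coprod.inl ≫ s.inl = coprod.inl ≫ s.inr := by
      simpa using (coprod.inl ≫ coprod.inl) ≫= h
    have h₂ : coprod.inl ≫ s.inl = coprod.inr ≫ s.inr := by
      simpa using (coprod.inr ≫ coprod.inl) ≫= h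
    refine coprod.hom_ext ?_ ?_
    · rw [coprod.inl_desc_assoc, Category.id_comp, h₁]
    · rw [coprod.inr_desc_assoc, Category.id_comp, h₂]
  · rw [← h₁, coprod.inl_desc_assoc, Category.id_comp]

lemma isPushout_frobenius_right (X : C) :
    IsPushout (coprod.map (𝟙 X) (fold X))
      ((coprod.associator X X X).inv ≫ coprod.map (fold X) (𝟙 X)) (fold X) (fold X) :=
  (isPushout_frobenius_left X).flip.of_iso (coprod.associator X X X) (Iso.refl _) (Iso.refl _)
    (Iso.refl _) (by simp) (by ext <;> simp) (by simp) (by simp)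

lemma incl_tensorμ (X Y Z W : C) :
    incl.map (tensorμ X Y Z W) = tensorμ (of X) (of Y) (of Z) (of W) := by
  dsimp only [tensorμ]
  iterate 4 rw [incl.map_comp]
  refine congrArg₂ (· ≫ ·) rfl (congrArg₂ (· ≫ ·) ?_ (congrArg₂ (· ≫ ·) ?_
    (congrArg₂ (· ≫ ·) ?_ rfl)))
  · exact (sum_incl (𝟙 X) (α_ Y Z W).inv).symm
  · exact ((congrArg (sum (incl.map (𝟙 X))) (sum_incl (β_ Y Z).hom (𝟙 W))).trans
      (sum_incl (𝟙 X) ((β_ Y Z).hom ⊗ₘ 𝟙 W))).symm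
  · exact (sum_incl (𝟙 X) (α_ Z Y W).hom).symm

/-- The Frobenius monoid on `X` in `Cospan(C)` given by the fold map `[1, 1] : X + X ⟶ X` and the
unique map `∅ ⟶ X`, together with the opposite cospans. -/
def frobenius (X : C) : SpecialCommFrobenius (of X) where
  mul := incl.map (fold X)
  one := incl.map (initial.to X)
  comul := opp (fold X)
  counit := opp (initial.to X)
  one_mul := ((congrArg (· ≫ _) (sum_incl (initial.to X) (𝟙 X))).trans
    (incl.map_comp _ _).symm).trans (congrArg incl.map (fold_unit X))
  mul_one := ((congrArg (· ≫ _) (sum_incl (𝟙 X) (initial.to X))).trans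
    (incl.map_comp _ _).symm).trans (congrArg incl.map (fold_unit' X))
  mul_assoc := ((congrArg (· ≫ _) (sum_incl (fold X) (𝟙 X))).trans
      (incl.map_comp _ _).symm).trans ((congrArg incl.map (fold_assoc X)).trans
    ((incl.map_comp _ _).trans (congrArg _ ((incl.map_comp _ _).trans
      (congrArg (· ≫ _) (sum_incl (𝟙 X) (fold X)).symm)))))
  counit_comul := ((congrArg _ (sum_opp (initial.to X) (𝟙 X))).trans
    (opp_comp _ _).symm).trans ((congrArg opp (fold_unit X)).trans (incl_eq_opp (λ_ X).symm).symm)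
  comul_counit := ((congrArg _ (sum_opp (𝟙 X) (initial.to X))).trans
    (opp_comp _ _).symm).trans ((congrArg opp (fold_unit' X)).trans (incl_eq_opp (ρ_ X).symm).symm)
  comul_assoc := ((congrArg _ (sum_opp (𝟙 X) (fold X))).trans
      (opp_comp _ _).symm).trans ((congrArg opp ((Iso.eq_inv_comp _).2 (fold_assoc X).symm)).trans
    ((((opp_comp _ _).trans (congrArg (· ≫ _) (opp_comp _ _))).trans
      (Category.assoc _ _ _)).trans
      (congrArg _ (congrArg₂ (· ≫ ·) (sum_opp (fold X) (𝟙 X)).symm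
        (incl_eq_opp (α_ X X X)).symm))))
  frobenius_left := (congrArg₂ (· ≫ ·) (sum_opp (fold X) (𝟙 X))
      ((congrArg _ (sum_incl (𝟙 X) (fold X))).trans (incl.map_comp _ _).symm)).trans
    ((opp_comp_incl (isPushout_frobenius_left X)).trans (incl_comp_opp _ _).symm)
  frobenius_right := (congrArg₂ (· ≫ ·) (sum_opp (𝟙 X) (fold X))
      ((congrArg _ (sum_incl (fold X) (𝟙 X))).trans (incl.map_comp _ _).symm)).trans
    ((opp_comp_incl (isPushout_frobenius_right X)).trans (incl_comp_opp _ _).symm)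
  special := opp_comp_incl (isPushout_fold X)
  mul_comm := (incl.map_comp _ _).symm.trans (congrArg incl.map (fold_comm X))
  comul_comm := (congrArg _ (incl_eq_opp (β_ X X))).trans ((opp_comp _ _).symm.trans
    (congrArg opp ((Iso.inv_comp_eq _).2 (fold_comm X).symm)))

/-- The hypergraph structure on `Cospan(C)`. -/
instance : HypergraphCategory (CospanCat C) where
  frob X := frobenius X.as
  mul_tensor X Y := (congrArg incl.map (fold_tensor X.as Y.as)).trans
    ((incl.map_comp _ _).trans (congrArg₂ (· ≫ ·) (incl_tensorμ _ _ _ _)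
      (sum_incl _ _).symm))
  one_tensor X Y := (congrArg incl.map (initialIsInitial.hom_ext _ _)).trans
    ((incl.map_comp (λ_ (𝟙_ C)).inv (initial.to X.as ⊗ₘ initial.to Y.as)).trans
      (congrArg _ (sum_incl _ _).symm))
  comul_tensor X Y :=
    let e : (X.as ⊗ X.as) ⊗ (Y.as ⊗ Y.as) ≅ (X.as ⊗ Y.as) ⊗ (X.as ⊗ Y.as) :=
      ⟨tensorμ _ _ _ _, tensorδ _ _ _ _, tensorμ_tensorδ _ _ _ _, tensorδ_tensorμ _ _ _ _⟩
    (congrArg opp (fold_tensor' X.as Y.as)).trans ((opp_comp e.inv _).trans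
      (congrArg₂ (· ≫ ·) (sum_opp _ _).symm
        ((incl_eq_opp e).symm.trans (incl_tensorμ _ _ _ _))))
  counit_tensor X Y := (congrArg opp (initialIsInitial.hom_ext _ _)).trans
    ((opp_comp (λ_ (𝟙_ C)).inv (initial.to X.as ⊗ₘ initial.to Y.as)).trans
      (congrArg₂ (· ≫ ·) (sum_opp _ _).symm (incl_eq_opp (λ_ (𝟙_ C))).symm))

end Monoidal

end CospanCat

end Cospans

section DecoratedCospans

variable {C : Type u₁} [Category.{v₁} C] {D : Type u₂} [Category.{v₂} D]

/-- The category `FCospan`: its objects are those of `C` and its morphisms are isomorphism classes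
of `F`-decorated cospans. -/
structure DecoratedCospanCat (F : C ⥤ D) where
  of ::
  as : C

variable [MonoidalCategory D] (F : C ⥤ D)

/-- An `F`-decorated cospan: a cospan together with an element `1 ⟶ FN` of the image of its
apex `N`. -/
structure DecoratedCospan (X Y : C) extends Cospan X Y where
  dec : 𝟙_ D ⟶ F.obj apex

namespace DecoratedCospan

/-- Two decorated cospans are isomorphic if there is an isomorphism of cospans carrying one
decoration to the other. -/
def setoid (X Y : C) : Setoid (DecoratedCospan F X Y) where
  r a b := ∃ e : a.apex ≅ b.apex, a.left ≫ e.hom = b.left ∧ a.right ≫ e.hom = b.right ∧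
    a.dec ≫ F.map e.hom = b.dec
  iseqv :=
    { refl := fun a => ⟨Iso.refl _, by simp, by simp, by simp⟩
      symm := fun ⟨e, h₁, h₂, h₃⟩ =>
        ⟨e.symm, by simp [← h₁], by simp [← h₂], by simp [← h₃, ← F.map_comp]⟩
      trans := fun ⟨e, h₁, h₂, h₃⟩ ⟨f, h₄, h₅, h₆⟩ =>
        ⟨e ≪≫ f, by simp [reassoc_of% h₁, h₄], by simp [reassoc_of% h₂, h₅],
          by simp [reassoc_of% h₃, h₆]⟩ }

end DecoratedCospan

namespace DecoratedCospanCat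

/-- Isomorphism classes of decorated cospans. -/
def Hom (X Y : DecoratedCospanCat F) : Type (max u₁ v₁ v₂) :=
  Quotient (DecoratedCospan.setoid F X.as Y.as)

instance : Quiver (DecoratedCospanCat F) := ⟨Hom F⟩

variable {F}

/-- The isomorphism class of a decorated cospan. -/
def mk {X Y : C} (a : DecoratedCospan F X Y) : (of X : DecoratedCospanCat F) ⟶ of Y :=
  Quotient.mk _ a

lemma mk_eq {X Y N M : C} {l : X ⟶ N} {r : Y ⟶ N} {l' : X ⟶ M} {r' : Y ⟶ M}
    {s : 𝟙_ D ⟶ F.obj N} {t : 𝟙_ D ⟶ F.obj M} (e : N ≅ M)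
    (h₁ : l ≫ e.hom = l') (h₂ : r ≫ e.hom = r') (h₃ : s ≫ F.map e.hom = t) :
    mk ⟨⟨N, l, r⟩, s⟩ = mk ⟨⟨M, l', r'⟩, t⟩ :=
  Quotient.sound ⟨e, h₁, h₂, h₃⟩

lemma mk_congr {X Y N : C} {l l' : X ⟶ N} {r r' : Y ⟶ N} {s s' : 𝟙_ D ⟶ F.obj N}
    (h₁ : l = l') (h₂ : r = r') (h₃ : s = s') :
    mk ⟨⟨N, l, r⟩, s⟩ = mk ⟨⟨N, l', r'⟩, s'⟩ := by rw [h₁, h₂, h₃]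

lemma exists_rep {X Y : DecoratedCospanCat F} (f : X ⟶ Y) :
    ∃ (N : C) (l : X.as ⟶ N) (r : Y.as ⟶ N) (s : 𝟙_ D ⟶ F.obj N), f = mk ⟨⟨N, l, r⟩, s⟩ := by
  obtain ⟨⟨⟨N, l, r⟩, s⟩, h⟩ := Quotient.exists_rep f
  exact ⟨N, l, r, s, h.symm⟩

end DecoratedCospanCat

variable [HasFiniteColimits C] [F.LaxMonoidal]

open Functor.LaxMonoidal (ε μ μ_natural associativity left_unitality right_unitality)

variable {F} in
/-- The product `1 ⟶ 1 ⊗ 1 ⟶ FN ⊗ FM ⟶ F(N + M)` of two elements `1 ⟶ FN` and `1 ⟶ FM`. -/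
def decProd {N M : C} (s : 𝟙_ D ⟶ F.obj N) (t : 𝟙_ D ⟶ F.obj M) : 𝟙_ D ⟶ F.obj (N ⨿ M) :=
  (λ_ (𝟙_ D)).inv ≫ (s ⊗ₘ t) ≫ μ F N M

/-- The empty decoration `1 ⟶ F∅ ⟶ FN`. -/
def emptyDec (N : C) : 𝟙_ D ⟶ F.obj N := ε F ≫ F.map (initial.to N)

section

variable {F}

lemma decProd_map {N M N' M' : C} (s : 𝟙_ D ⟶ F.obj N) (t : 𝟙_ D ⟶ F.obj M)
    (f : N ⟶ N') (g : M ⟶ M') :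
    decProd (s ≫ F.map f) (t ≫ F.map g) = decProd s t ≫ F.map (coprod.map f g) := by
  have h : (F.map f ⊗ₘ F.map g) ≫ μ F N' M' = μ F N M ≫ F.map (coprod.map f g) :=
    μ_natural F f g
  simp only [decProd, Category.assoc, ← h, tensorHom_comp_tensorHom_assoc]

lemma decProd_assoc {N M P : C} (s : 𝟙_ D ⟶ F.obj N) (t : 𝟙_ D ⟶ F.obj M)
    (u : 𝟙_ D ⟶ F.obj P) :
    decProd (decProd s t) u ≫ F.map (coprod.associator N M P).hom =
      decProd s (decProd t u) := by
  have h : μ F N M ▷ F.obj P ≫ μ F (N ⨿ M) P ≫ F.map (coprod.associator N M P).hom =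
    (α_ (F.obj N) (F.obj M) (F.obj P)).hom ≫ F.obj N ◁ μ F M P ≫ μ F N (M ⨿ P) :=
    associativity F N M P
  have e : (λ_ (𝟙_ D)).inv ▷ 𝟙_ D ≫ (α_ _ _ _).hom = 𝟙_ D ◁ (λ_ (𝟙_ D)).inv := by
    monoidal
  calc
    _ = (λ_ (𝟙_ D)).inv ≫ (λ_ (𝟙_ D)).inv ▷ 𝟙_ D ≫ ((s ⊗ₘ t) ⊗ₘ u) ≫
        μ F N M ▷ F.obj P ≫ μ F (N ⨿ M) P ≫ F.map (coprod.associator N M P).hom := by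
      simp only [decProd, Category.assoc, ← tensorHom_id, tensorHom_comp_tensorHom_assoc,
        Category.id_comp, Category.comp_id]
    _ = (λ_ (𝟙_ D)).inv ≫ 𝟙_ D ◁ (λ_ (𝟙_ D)).inv ≫ (s ⊗ₘ (t ⊗ₘ u)) ≫
        F.obj N ◁ μ F M P ≫ μ F N (M ⨿ P) := by
      rw [h, associator_naturality_assoc, reassoc_of% e]
    _ = _ := by
      simp only [decProd, ← id_tensorHom, tensorHom_comp_tensorHom_assoc,
        Category.id_comp, Category.comp_id]

lemma decProd_unit_left {N : C} (s : 𝟙_ D ⟶ F.obj N) :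
    decProd (ε F) s ≫ F.map (coprod.desc (initial.to N) (𝟙 N)) = s := by
  have h : (λ_ (F.obj N)).hom =
      ε F ▷ F.obj N ≫ μ F (⊥_ C) N ≫ F.map (coprod.desc (initial.to N) (𝟙 N)) :=
    left_unitality F N
  rw [decProd, Category.assoc, Category.assoc, tensorHom_def', Category.assoc]
  refine (congrArg (fun x => (λ_ (𝟙_ D)).inv ≫ 𝟙_ D ◁ s ≫ x) h.symm).trans ?_
  rw [leftUnitor_naturality, Iso.inv_hom_id_assoc]

lemma decProd_unit_right {N : C} (s : 𝟙_ D ⟶ F.obj N) :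
    decProd s (ε F) ≫ F.map (coprod.desc (𝟙 N) (initial.to N)) = s := by
  have h : (ρ_ (F.obj N)).hom =
      F.obj N ◁ ε F ≫ μ F N (⊥_ C) ≫ F.map (coprod.desc (𝟙 N) (initial.to N)) :=
    right_unitality F N
  rw [decProd, Category.assoc, Category.assoc, MonoidalCategory.tensorHom_def, Category.assoc]
  refine (congrArg (fun x => (λ_ (𝟙_ D)).inv ≫ s ▷ 𝟙_ D ≫ x) h.symm).trans ?_
  rw [rightUnitor_naturality, unitors_inv_equal, Iso.inv_hom_id_assoc]

lemma decProd_empty_left {N M P : C} (s : 𝟙_ D ⟶ F.obj N) (k : M ⟶ P) (j : N ⟶ P) :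
    decProd (emptyDec F M) s ≫ F.map (coprod.desc k j) = s ≫ F.map j := by
  have h := decProd_map (ε F) s (initial.to M) (𝟙 N)
  rw [F.map_id, Category.comp_id] at h
  refine (congrArg (· ≫ _) h).trans ?_
  conv_rhs => rw [← decProd_unit_left s]
  rw [Category.assoc, Category.assoc, ← F.map_comp, ← F.map_comp]
  refine congrArg (_ ≫ F.map ·) ?_
  refine coprod.hom_ext (initialIsInitial.hom_ext _ _) ?_
  simp [coprod.inr_desc]

lemma decProd_empty_right {N M P : C} (s : 𝟙_ D ⟶ F.obj N) (j : N ⟶ P) (k : M ⟶ P) :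
    decProd s (emptyDec F M) ≫ F.map (coprod.desc j k) = s ≫ F.map j := by
  have h := decProd_map s (ε F) (𝟙 N) (initial.to M)
  rw [F.map_id, Category.comp_id] at h
  refine (congrArg (· ≫ _) h).trans ?_
  conv_rhs => rw [← decProd_unit_right s]
  rw [Category.assoc, Category.assoc, ← F.map_comp, ← F.map_comp]
  refine congrArg (_ ≫ F.map ·) ?_
  refine coprod.hom_ext ?_ (initialIsInitial.hom_ext _ _)
  simp [coprod.inl_desc]

lemma emptyDec_map {N M : C} (f : N ⟶ M) : emptyDec F N ≫ F.map f = emptyDec F M := by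
  rw [emptyDec, emptyDec, Category.assoc, ← F.map_comp, initial.to_comp]

end

namespace DecoratedCospan

variable {F}

/-- Composition of decorated cospans: the cospans are composed by pushout, and the decoration is
the image of the product of the decorations under `F[j_N, j_M] : F(N + M) ⟶ F(N +_Y M)`. -/
@[simps toCospan dec]
def comp {X Y Z : C} (a : DecoratedCospan F X Y) (b : DecoratedCospan F Y Z) :
    DecoratedCospan F X Z where
  toCospan := a.toCospan.comp b.toCospan
  dec := decProd a.dec b.dec ≫
    F.map (coprod.desc (pushout.inl a.right b.left) (pushout.inr a.right b.left))

/-- The monoidal product of decorated cospans. -/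
@[simps toCospan dec]
def sum {X Y X' Y' : C} (a : DecoratedCospan F X Y) (b : DecoratedCospan F X' Y') :
    DecoratedCospan F (X ⨿ X') (Y ⨿ Y') where
  toCospan := a.toCospan.sum b.toCospan
  dec := decProd a.dec b.dec

variable (F)

/-- A cospan decorated with the empty decoration. -/
@[simps toCospan dec]
def empty {X Y : C} (a : Cospan X Y) : DecoratedCospan F X Y where
  toCospan := a
  dec := emptyDec F a.apex

end DecoratedCospan

namespace DecoratedCospanCat

variable {F}

lemma comp_aux {X Y Z : C} {a a' : DecoratedCospan F X Y} {b b' : DecoratedCospan F Y Z}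
    (h : (DecoratedCospan.setoid F X Y).r a a') (h' : (DecoratedCospan.setoid F Y Z).r b b') :
    (DecoratedCospan.setoid F X Z).r (a.comp b) (a'.comp b') := by
  obtain ⟨e, h₁, h₂, h₃⟩ := h
  obtain ⟨f, h₄, h₅, h₆⟩ := h'
  have p := (IsPushout.of_hasPushout a.right b.left).of_iso (f' := a'.right) (g' := b'.left)
    (inl' := e.inv ≫ pushout.inl _ _) (inr' := f.inv ≫ pushout.inr _ _) (Iso.refl _) e f
    (Iso.refl _) (by simp [h₂]) (by simp [h₄]) (by simp) (by simp)
  have hl := p.inl_isoPushout_hom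
  have hr := p.inr_isoPushout_hom
  simp only [Category.assoc] at hl hr
  refine ⟨p.isoPushout, ?_, ?_, ?_⟩
  · simp only [DecoratedCospan.comp, Cospan.comp, Category.assoc, ← h₁, ← hl,
      Iso.hom_inv_id_assoc]
  · simp only [DecoratedCospan.comp, Cospan.comp, Category.assoc, ← h₅, ← hr,
      Iso.hom_inv_id_assoc]
  · refine (Category.assoc _ _ _).trans ((congrArg _ (F.map_comp _ _).symm).trans ?_)
    refine Eq.trans ?_ (congrArg (· ≫ _) (congrArg₂ decProd h₃ h₆))
    refine Eq.trans ?_ (congrArg (· ≫ _) (decProd_map a.dec b.dec e.hom f.hom)).symm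
    refine Eq.trans (congrArg (_ ≫ F.map ·) ?_)
      ((congrArg _ (F.map_comp _ _)).trans (Category.assoc _ _ _).symm)
    refine (coprod.desc_comp _ _ _).trans (Eq.trans ?_ (coprod.map_desc _ _ _ _).symm)
    exact congrArg₂ coprod.desc ((Iso.inv_comp_eq e).1 hl) ((Iso.inv_comp_eq f).1 hr)

instance : CategoryStruct (DecoratedCospanCat F) where
  id X := mk (DecoratedCospan.empty F (Cospan.id X.as))
  comp f g := Quotient.map₂ DecoratedCospan.comp (fun _ _ h _ _ h' => comp_aux h h') f g

/-- The composite may be computed by any pushout. -/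
lemma comp_eq {X Y Z N M P : C} {l : X ⟶ N} {r : Y ⟶ N} {l' : Y ⟶ M} {r' : Z ⟶ M}
    {s : 𝟙_ D ⟶ F.obj N} {t : 𝟙_ D ⟶ F.obj M} {j : N ⟶ P} {k : M ⟶ P} (h : IsPushout r l' j k) :
    mk ⟨⟨N, l, r⟩, s⟩ ≫ mk ⟨⟨M, l', r'⟩, t⟩ =
      mk ⟨⟨P, l ≫ j, r' ≫ k⟩, decProd s t ≫ F.map (coprod.desc j k)⟩ :=
  mk_eq h.isoPushout.symm (by simp) (by simp) ((Category.assoc _ _ _).trans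
    (congrArg _ ((F.map_comp _ _).symm.trans (congrArg F.map
      ((coprod.desc_comp _ _ _).trans (congrArg₂ coprod.desc
        h.inl_isoPushout_inv h.inr_isoPushout_inv))))))

instance : Category (DecoratedCospanCat F) where
  id_comp {X Y} f := by
    obtain ⟨N, l, r, s, rfl⟩ := exists_rep f
    refine (comp_eq (IsPushout.id_horiz l)).trans (mk_congr (by simp) (by simp) ?_)
    exact (decProd_empty_left _ _ _).trans (by simp)
  comp_id {X Y} f := by
    obtain ⟨N, l, r, s, rfl⟩ := exists_rep f
    refine (comp_eq (IsPushout.id_vert r)).trans (mk_congr (by simp) (by simp) ?_)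
    exact (decProd_empty_right _ _ _).trans (by simp)
  assoc {X Y Z W} f g h := by
    obtain ⟨N, l, r, s, rfl⟩ := exists_rep f
    obtain ⟨M, l', r', t, rfl⟩ := exists_rep g
    obtain ⟨P, l'', r'', u, rfl⟩ := exists_rep h
    have p := IsPushout.of_hasPushout r l'
    have q := IsPushout.of_hasPushout r' l''
    have w := IsPushout.of_hasPushout (pushout.inr r l') (pushout.inl r' l'')
    refine ((comp_eq (q.paste_horiz w)).trans
      (mk_congr (Category.assoc _ _ _) (Category.assoc _ _ _).symm ?_)).trans
      (comp_eq (p.paste_vert w)).symm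
    have h₁ := decProd_map (decProd s t) u
      (coprod.desc (pushout.inl r l') (pushout.inr r l')) (𝟙 P)
    have h₂ := decProd_map s (decProd t u) (𝟙 N)
      (coprod.desc (pushout.inl r' l'') (pushout.inr r' l''))
    rw [F.map_id, Category.comp_id] at h₁ h₂
    refine (congrArg (· ≫ _) h₁).trans (Eq.trans ?_ (congrArg (· ≫ _) h₂).symm)
    rw [← decProd_assoc]
    simp only [Category.assoc, ← F.map_comp]
    refine congrArg (_ ≫ F.map ·) ?_
    ext <;> simp [coprod.inl_desc, coprod.inr_desc, pushout.condition]

variable (F)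

lemma empty_aux {X Y : C} {a b : Cospan X Y} (h : (Cospan.setoid X Y).r a b) :
    (DecoratedCospan.setoid F X Y).r (DecoratedCospan.empty F a) (DecoratedCospan.empty F b) := by
  obtain ⟨e, h₁, h₂⟩ := h
  exact ⟨e, h₁, h₂, emptyDec_map e.hom⟩

/-- The identity-on-objects functor `Cospan(C) ⥤ FCospan` equipping each cospan with the empty
decoration. -/
def ofCospan : CospanCat C ⥤ DecoratedCospanCat F where
  obj X := of X.as
  map f := Quotient.map (DecoratedCospan.empty F)
    (fun _ _ h => empty_aux F h) f
  map_id _ := rfl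
  map_comp {X Y Z} f g := by
    obtain ⟨N, l, r, rfl⟩ := CospanCat.exists_rep f
    obtain ⟨M, l', r', rfl⟩ := CospanCat.exists_rep g
    refine mk_congr rfl rfl (Eq.symm ?_)
    exact (decProd_empty_left _ _ _).trans (emptyDec_map _)

lemma ofCospan_map_mk {X Y : C} (a : Cospan X Y) :
    (ofCospan F).map (CospanCat.mk a) = mk (DecoratedCospan.empty F a) := rfl

end DecoratedCospanCat

end DecoratedCospans

end

/-! Decorations form a commutative monoid graded by apices: `decProd` multiplies `1 ⟶ FN` and `1 ⟶
FM` into `1 ⟶ F(N + M)`, is natural in both apices, is associative and unital by the lax monoidal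
axioms, and is commutative because `F` is braided. All these laws hold up to the structural
isomorphisms of `(C, +)`.

The axioms to prove are of two kinds. Those involving arbitrary morphisms of `FCospan`
(functoriality of the tensor product, naturality of associator, unitors and braiding) hold for the
underlying cospans as in `Cospan(C)`; for the decorations they reduce to the laws of `decProd`. The
main case is functoriality (`sum_comp_sum`), which needs the interchange law `decProd_interchange`.
Those involving only structure maps (pentagon, triangle, hexagons, symmetry, and the Frobenius and
hypergraph equations) are equations in `Cospan(C)`. The structure maps of `FCospan` are defined as
images under `ofCospan`, which preserves composition and, by `sum_ofCospan`, the product of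
morphisms, so these equations carry over.

A braiding on `D` is enough to obtain a symmetric category: the symmetry of `FCospan` comes from
`(C, +)`, and `D` enters only through elements `1 ⟶ FN`, where only the trivial braiding of `1` with
itself matters. -/

noncomputable section

variable {C : Type u₁} [Category.{v₁} C] [HasFiniteColimits C]
  {D : Type u₂} [Category.{v₂} D] [MonoidalCategory D]

/-! ### Products of decorations: naturality, associativity, empty decorations -/

section Decorations

variable {F : C ⥤ D} [F.LaxMonoidal]

lemma decProd_map_left {N M N' : C} (s : 𝟙_ D ⟶ F.obj N) (t : 𝟙_ D ⟶ F.obj M) (f : N ⟶ N') :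
    decProd (s ≫ F.map f) t = decProd s t ≫ F.map (coprod.map f (𝟙 M)) := by
  simpa using decProd_map s t f (𝟙 M)

lemma decProd_map_right {N M M' : C} (s : 𝟙_ D ⟶ F.obj N) (t : 𝟙_ D ⟶ F.obj M) (g : M ⟶ M') :
    decProd s (t ≫ F.map g) = decProd s t ≫ F.map (coprod.map (𝟙 N) g) := by
  simpa using decProd_map s t (𝟙 N) g

lemma decProd_assoc_inv {N M P : C} (s : 𝟙_ D ⟶ F.obj N) (t : 𝟙_ D ⟶ F.obj M)
    (u : 𝟙_ D ⟶ F.obj P) :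
    decProd s (decProd t u) ≫ F.map (coprod.associator N M P).inv =
      decProd (decProd s t) u := by
  rw [← decProd_assoc, Category.assoc, ← F.map_comp, Iso.hom_inv_id, F.map_id, Category.comp_id]

/-- The unit law `decProd_empty_left` applies with the two coproduct injections, whose copairing is
the identity. This is what makes `ofCospan` preserve the product of morphisms. -/
lemma decProd_emptyDec (N M : C) :
    decProd (emptyDec F N) (emptyDec F M) = emptyDec F (N ⨿ M) := by
  have h := decProd_empty_left (emptyDec F M) (coprod.inl : N ⟶ N ⨿ M) coprod.inr
  rwa [coprod.desc_inl_inr, F.map_id, Category.comp_id, emptyDec_map] at h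

end Decorations

/-! ### Products of decorations: commutativity and interchange -/

/-- Naturality moves the braiding from `FN ⊗ FM` back to `1 ⊗ 1`, where it is the identity because
the left and right unitors of `1` agree. -/
lemma decProd_braiding [BraidedCategory D] {F : C ⥤ D} [F.LaxBraided] {N M : C}
    (s : 𝟙_ D ⟶ F.obj N) (t : 𝟙_ D ⟶ F.obj M) :
    decProd s t ≫ F.map (coprod.braiding N M).hom = decProd t s := by
  have h : Functor.LaxMonoidal.μ F N M ≫ F.map (coprod.braiding N M).hom =
      (β_ (F.obj N) (F.obj M)).hom ≫ Functor.LaxMonoidal.μ F M N :=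
    Functor.LaxBraided.braided N M
  rw [decProd, Category.assoc, Category.assoc, h, BraidedCategory.braiding_naturality_assoc,
    braiding_tensorUnit_left, ← unitors_inv_equal, Category.assoc, Iso.inv_hom_id_assoc, decProd]

/-- The products of elements satisfy the interchange law. -/
lemma decProd_interchange [BraidedCategory D] {F : C ⥤ D} [F.LaxBraided] {N M P Q : C}
    (s : 𝟙_ D ⟶ F.obj N) (t : 𝟙_ D ⟶ F.obj M) (u : 𝟙_ D ⟶ F.obj P) (v : 𝟙_ D ⟶ F.obj Q) :
    decProd (decProd s t) (decProd u v) ≫ F.map (coprod.desc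
        (coprod.map coprod.inl coprod.inl) (coprod.map coprod.inr coprod.inr)) =
      decProd (decProd s u) (decProd t v) := by
  -- Both sides are rebracketed so that the middle factors `t`, `u` are adjacent, and are then
  -- swapped on the right-hand side. Each becomes `decProd s (decProd (decProd t u) v)` followed by
  -- the image of a map in `C`, which can be compared on the four summands.
  rw [← decProd_assoc_inv s t, ← decProd_assoc_inv s u, ← decProd_assoc t, ← decProd_assoc u,
    ← decProd_braiding t u]
  simp only [decProd_map_left, decProd_map_right, Category.assoc, ← F.map_comp]
  refine congrArg (_ ≫ F.map ·) ?_
  ext <;> simp [coprod.inl_desc, coprod.inr_desc]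

namespace DecoratedCospanCat

/-! ### Undecorated morphisms inside `FCospan`; the wide embedding -/

section

variable {F : C ⥤ D} [F.LaxMonoidal]

/-- An empty decoration is neutral in the composite. With `comp_ofCospan_incl`, this computes both
sides of each naturality square for a structure map without forming a new pushout. -/
lemma ofCospan_incl_comp {X Y Z N : C} (f : X ⟶ Y) (l : Y ⟶ N) (r : Z ⟶ N)
    (s : 𝟙_ D ⟶ F.obj N) :
    (ofCospan F).map (CospanCat.incl.map f) ≫ mk ⟨⟨N, l, r⟩, s⟩ = mk ⟨⟨N, f ≫ l, r⟩, s⟩ :=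
  (comp_eq (IsPushout.id_horiz l)).trans (mk_congr rfl (by simp)
    ((decProd_empty_left _ _ _).trans (by simp)))

/-- Invertibility of `e` allows its cospan to be rewritten with left leg an identity, so that the
pushout is again trivial. -/
lemma comp_ofCospan_incl {X Y Z N : C} (e : Y ≅ Z) (l : X ⟶ N) (r : Y ⟶ N)
    (s : 𝟙_ D ⟶ F.obj N) :
    mk ⟨⟨N, l, r⟩, s⟩ ≫ (ofCospan F).map (CospanCat.incl.map e.hom) =
      mk ⟨⟨N, l, e.inv ≫ r⟩, s⟩ := by
  rw [CospanCat.incl_eq_opp]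
  exact (comp_eq (IsPushout.id_vert r)).trans (mk_congr (by simp) rfl
    ((decProd_empty_right _ _ _).trans (by simp)))

lemma sum_aux {X Y X' Y' : C} {a b : DecoratedCospan F X Y} {a' b' : DecoratedCospan F X' Y'}
    (h : (DecoratedCospan.setoid F X Y).r a b) (h' : (DecoratedCospan.setoid F X' Y').r a' b') :
    (DecoratedCospan.setoid F (X ⨿ X') (Y ⨿ Y')).r (a.sum a') (b.sum b') := by
  obtain ⟨e, h₁, h₂, h₃⟩ := h
  obtain ⟨e', h₄, h₅, h₆⟩ := h'
  refine ⟨coprod.mapIso e e', ?_, ?_, ?_⟩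
  · simp only [DecoratedCospan.sum, Cospan.sum, coprod.mapIso_hom, coprod.map_map, h₁, h₄]
  · simp only [DecoratedCospan.sum, Cospan.sum, coprod.mapIso_hom, coprod.map_map, h₂, h₅]
  · exact (decProd_map _ _ _ _).symm.trans (congrArg₂ decProd h₃ h₆)

/-- The monoidal product of two morphisms of `FCospan`. -/
def sum {X Y X' Y' : DecoratedCospanCat F} (f : X ⟶ Y) (g : X' ⟶ Y') :
    (of (X.as ⨿ X'.as) : DecoratedCospanCat F) ⟶ of (Y.as ⨿ Y'.as) :=
  Quotient.map₂ DecoratedCospan.sum (fun _ _ h _ _ h' => sum_aux h h') f g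

/-- This transports equations from `Cospan(C)` to `FCospan`: the product of empty decorations is
empty. -/
lemma sum_ofCospan {X Y X' Y' : CospanCat C} (f : X ⟶ Y) (g : X' ⟶ Y') :
    sum ((ofCospan F).map f) ((ofCospan F).map g) = (ofCospan F).map (f ⊗ₘ g) := by
  obtain ⟨N, l, r, rfl⟩ := CospanCat.exists_rep f
  obtain ⟨M, l', r', rfl⟩ := CospanCat.exists_rep g
  exact mk_congr rfl rfl (decProd_emptyDec N M)

lemma sum_ofCospan_id_left (X : CospanCat C) {Y Z : CospanCat C} (f : Y ⟶ Z) :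
    sum (𝟙 ((ofCospan F).obj X)) ((ofCospan F).map f) = (ofCospan F).map (X ◁ f) := by
  rw [← (ofCospan F).map_id, sum_ofCospan, id_tensorHom]

lemma sum_ofCospan_id_right {X Y : CospanCat C} (f : X ⟶ Y) (Z : CospanCat C) :
    sum ((ofCospan F).map f) (𝟙 ((ofCospan F).obj Z)) = (ofCospan F).map (f ▷ Z) := by
  rw [← (ofCospan F).map_id, sum_ofCospan, tensorHom_id]

variable (F)

/-- An isomorphism of decorated cospans is in particular one of the underlying cospans; its
compatibility with decorations is discarded. -/
lemma ofCospan_faithful : (ofCospan F).Faithful where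
  map_injective {_ _} f g h := by
    obtain ⟨N, l, r, rfl⟩ := CospanCat.exists_rep f
    obtain ⟨M, l', r', rfl⟩ := CospanCat.exists_rep g
    obtain ⟨e, h₁, h₂, -⟩ := Quotient.exact h
    exact CospanCat.mk_eq e h₁ h₂

lemma ofCospan_isWideEmbedding : IsWideEmbedding (ofCospan F) where
  faithful := ofCospan_faithful F
  bijective_obj := ⟨fun _ _ h => congrArg (fun Z => CospanCat.of Z.as) h,
    fun X => ⟨CospanCat.of X.as, rfl⟩⟩

end

/-! ### The symmetric monoidal structure of `FCospan` -/

variable [BraidedCategory D] {F : C ⥤ D} [F.LaxBraided]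

/-- Coproducts of pushouts are pushouts, which settles the cospans. The decorations multiply in the
orders `(s s')(t t')` and `(s t)(s' t')`, so the interchange law is needed. -/
lemma sum_comp_sum {X Y Z X' Y' Z' : DecoratedCospanCat F} (f : X ⟶ Y) (f' : X' ⟶ Y')
    (g : Y ⟶ Z) (g' : Y' ⟶ Z') : sum f f' ≫ sum g g' = sum (f ≫ g) (f' ≫ g') := by
  obtain ⟨N, l, r, s, rfl⟩ := exists_rep f
  obtain ⟨M, l', r', s', rfl⟩ := exists_rep f'
  obtain ⟨P, i, o, t, rfl⟩ := exists_rep g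
  obtain ⟨Q, i', o', t', rfl⟩ := exists_rep g'
  have p := IsPushout.of_hasPushout r i
  have q := IsPushout.of_hasPushout r' i'
  refine (comp_eq (CospanCat.isPushout_coprodMap p q)).trans ?_
  rw [comp_eq p, comp_eq q]
  refine mk_congr (by simp) (by simp) ?_
  refine Eq.trans ?_ (decProd_map _ _ _ _).symm
  refine Eq.trans ?_ (congrArg (· ≫ _) (decProd_interchange s s' t t'))
  rw [Category.assoc, ← F.map_comp]
  refine congrArg (_ ≫ F.map ·) ?_
  ext <;> simp [coprod.inl_desc, coprod.inr_desc]

/-- The monoidal structure on `FCospan`: the monoidal product of morphisms is the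
coproduct of cospans with the product decoration, and the coherence isomorphisms are those of
`Cospan(C)` with the empty decoration. -/
instance : MonoidalCategory (DecoratedCospanCat F) :=
  letI : MonoidalCategoryStruct (DecoratedCospanCat F) :=
    { tensorObj X Y := of (X.as ⨿ Y.as)
      tensorUnit := of (⊥_ C)
      tensorHom f g := sum f g
      whiskerLeft X _ _ g := sum (𝟙 X) g
      whiskerRight f X := sum f (𝟙 X)
      associator X Y Z := (ofCospan F).mapIso
        (α_ (CospanCat.of X.as) (CospanCat.of Y.as) (CospanCat.of Z.as))
      leftUnitor X := (ofCospan F).mapIso (λ_ (CospanCat.of X.as))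
      rightUnitor X := (ofCospan F).mapIso (ρ_ (CospanCat.of X.as)) }
  .ofTensorHom
    (id_tensorHom_id := fun ⟨X⟩ ⟨Y⟩ =>
      (sum_ofCospan_id_left (CospanCat.of X) (𝟙 (CospanCat.of Y))).trans
        ((congrArg (ofCospan F).map (whiskerLeft_id _ _)).trans ((ofCospan F).map_id _)))
    (id_tensorHom := fun _ _ _ _ => rfl)
    (tensorHom_id := fun _ _ => rfl)
    (tensorHom_comp_tensorHom := fun f₁ f₂ g₁ g₂ => sum_comp_sum f₁ f₂ g₁ g₂)
    (associator_naturality := fun f g h => by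
      obtain ⟨N, l, r, s, rfl⟩ := exists_rep f
      obtain ⟨M, l', r', t, rfl⟩ := exists_rep g
      obtain ⟨P, l'', r'', u, rfl⟩ := exists_rep h
      refine (comp_ofCospan_incl (α_ _ _ _) _ _ _).trans ?_
      refine Eq.trans ?_ (ofCospan_incl_comp _ _ _ _).symm
      -- The apices are identified by the associator of `(C, +)`: its naturality handles the legs,
      -- and associativity of `decProd` handles the decorations.
      refine mk_eq (α_ N M P) (associator_naturality _ _ _) ?_ (decProd_assoc s t u)
      rw [Category.assoc, Iso.inv_comp_eq]
      exact associator_naturality _ _ _)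
    (leftUnitor_naturality := fun f => by
      obtain ⟨N, l, r, s, rfl⟩ := exists_rep f
      refine (comp_ofCospan_incl (λ_ _) _ _ _).trans ?_
      refine Eq.trans ?_ (ofCospan_incl_comp _ _ _ _).symm
      refine mk_eq (λ_ N) (leftUnitor_naturality _) ?_
        -- The identity of the unit object carries the empty decoration on `∅`, and the left unitor
        -- of `(C, +)` at `N` is this copairing.
        ((decProd_empty_left s (initial.to N) (𝟙 N)).trans (by simp))
      rw [Category.assoc, Iso.inv_comp_eq]
      exact leftUnitor_naturality _)
    (rightUnitor_naturality := fun f => by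
      obtain ⟨N, l, r, s, rfl⟩ := exists_rep f
      refine (comp_ofCospan_incl (ρ_ _) _ _ _).trans ?_
      refine Eq.trans ?_ (ofCospan_incl_comp _ _ _ _).symm
      refine mk_eq (ρ_ N) (rightUnitor_naturality _) ?_
        ((decProd_empty_right s (𝟙 N) (initial.to N)).trans (by simp))
      rw [Category.assoc, Iso.inv_comp_eq]
      exact rightUnitor_naturality _)
    (pentagon := fun X Y Z W => by
      -- Every morphism in the pentagon is an image under `ofCospan`, so the identity is inherited
      -- from `Cospan(C)`.
      have h := congrArg (ofCospan F).map (pentagon (CospanCat.of X.as) (CospanCat.of Y.as)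
        (CospanCat.of Z.as) (CospanCat.of W.as))
      simp only [Functor.map_comp, ← sum_ofCospan_id_left, ← sum_ofCospan_id_right] at h
      exact h)
    (triangle := fun X Y => by
      have h := congrArg (ofCospan F).map (triangle (CospanCat.of X.as) (CospanCat.of Y.as))
      simp only [Functor.map_comp, ← sum_ofCospan_id_left, ← sum_ofCospan_id_right] at h
      exact h)

lemma ofCospan_tensorHom {X Y X' Y' : CospanCat C} (f : X ⟶ Y) (g : X' ⟶ Y') :
    (ofCospan F).map (f ⊗ₘ g) = (ofCospan F).map f ⊗ₘ (ofCospan F).map g :=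
  (sum_ofCospan f g).symm

lemma ofCospan_whiskerLeft (X : CospanCat C) {Y Z : CospanCat C} (f : Y ⟶ Z) :
    (ofCospan F).map (X ◁ f) = (ofCospan F).obj X ◁ (ofCospan F).map f :=
  (sum_ofCospan_id_left X f).symm

lemma ofCospan_whiskerRight {X Y : CospanCat C} (f : X ⟶ Y) (Z : CospanCat C) :
    (ofCospan F).map (f ▷ Z) = (ofCospan F).map f ▷ (ofCospan F).obj Z :=
  (sum_ofCospan_id_right f Z).symm

/-- The symmetry of `FCospan` is that of `(C, +)`, with the empty decoration. -/
instance : SymmetricCategory (DecoratedCospanCat F) where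
  braiding X Y := (ofCospan F).mapIso (β_ (CospanCat.of X.as) (CospanCat.of Y.as))
  braiding_naturality_right X Y Z f := by
    obtain ⟨N, l, r, s, rfl⟩ := exists_rep f
    refine (comp_ofCospan_incl (β_ _ _) _ _ _).trans ?_
    refine Eq.trans ?_ (ofCospan_incl_comp _ _ _ _).symm
    refine mk_eq (β_ _ N) (BraidedCategory.braiding_naturality_right _ _) ?_
      -- One factor here is the empty decoration of an identity; commutativity of `decProd` moves it
      -- to the other side.
      (decProd_braiding _ _)
    rw [Category.assoc, Iso.inv_comp_eq]
    exact BraidedCategory.braiding_naturality_right _ _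
  braiding_naturality_left f Z := by
    obtain ⟨N, l, r, s, rfl⟩ := exists_rep f
    refine (comp_ofCospan_incl (β_ _ _) _ _ _).trans ?_
    refine Eq.trans ?_ (ofCospan_incl_comp _ _ _ _).symm
    refine mk_eq (β_ N _) (BraidedCategory.braiding_naturality_left _ _) ?_
      (decProd_braiding _ _)
    rw [Category.assoc, Iso.inv_comp_eq]
    exact BraidedCategory.braiding_naturality_left _ _
  hexagon_forward X Y Z := by
    have h := congrArg (ofCospan F).map (BraidedCategory.hexagon_forward (CospanCat.of X.as)
      (CospanCat.of Y.as) (CospanCat.of Z.as))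
    simp only [Functor.map_comp, ofCospan_whiskerLeft, ofCospan_whiskerRight] at h
    exact h
  hexagon_reverse X Y Z := by
    have h := congrArg (ofCospan F).map (BraidedCategory.hexagon_reverse (CospanCat.of X.as)
      (CospanCat.of Y.as) (CospanCat.of Z.as))
    simp only [Functor.map_comp, ofCospan_whiskerLeft, ofCospan_whiskerRight] at h
    exact h
  symmetry X Y := by
    have h := congrArg (ofCospan F).map
      (SymmetricCategory.symmetry (CospanCat.of X.as) (CospanCat.of Y.as))
    simp only [Functor.map_comp] at h
    exact h

/-! ### Transport of the Frobenius and hypergraph structure -/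

/-- The image of a special commutative Frobenius monoid of `Cospan(C)` in `FCospan`. -/
def mapFrobenius {X : CospanCat C} (A : SpecialCommFrobenius X) :
    SpecialCommFrobenius ((ofCospan F).obj X) where
  mul := (ofCospan F).map A.mul
  one := (ofCospan F).map A.one
  comul := (ofCospan F).map A.comul
  counit := (ofCospan F).map A.counit
  one_mul := by
    have h := congrArg (ofCospan F).map A.one_mul
    simp only [Functor.map_comp, ofCospan_whiskerRight] at h
    exact h
  mul_one := by
    have h := congrArg (ofCospan F).map A.mul_one
    simp only [Functor.map_comp, ofCospan_whiskerLeft] at h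
    exact h
  mul_assoc := by
    have h := congrArg (ofCospan F).map A.mul_assoc
    simp only [Functor.map_comp, ofCospan_whiskerLeft, ofCospan_whiskerRight] at h
    exact h
  counit_comul := by
    have h := congrArg (ofCospan F).map A.counit_comul
    simp only [Functor.map_comp, ofCospan_whiskerRight] at h
    exact h
  comul_counit := by
    have h := congrArg (ofCospan F).map A.comul_counit
    simp only [Functor.map_comp, ofCospan_whiskerLeft] at h
    exact h
  comul_assoc := by
    have h := congrArg (ofCospan F).map A.comul_assoc
    simp only [Functor.map_comp, ofCospan_whiskerLeft, ofCospan_whiskerRight] at h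
    exact h
  frobenius_left := by
    have h := congrArg (ofCospan F).map A.frobenius_left
    simp only [Functor.map_comp, ofCospan_whiskerLeft, ofCospan_whiskerRight] at h
    exact h
  frobenius_right := by
    have h := congrArg (ofCospan F).map A.frobenius_right
    simp only [Functor.map_comp, ofCospan_whiskerLeft, ofCospan_whiskerRight] at h
    exact h
  special := by
    have h := congrArg (ofCospan F).map A.special
    simp only [Functor.map_comp] at h
    exact h
  mul_comm := by
    have h := congrArg (ofCospan F).map A.mul_comm
    simp only [Functor.map_comp] at h
    exact h
  comul_comm := by
    have h := congrArg (ofCospan F).map A.comul_comm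
    simp only [Functor.map_comp] at h
    exact h

/-- The middle-four exchange is built from associators, a braiding and whiskerings, all preserved
strictly; it occurs in the hypergraph axioms for `mul` and `comul`. -/
lemma ofCospan_tensorμ (X Y Z W : CospanCat C) :
    (ofCospan F).map (tensorμ X Y Z W) = tensorμ ((ofCospan F).obj X) ((ofCospan F).obj Y)
      ((ofCospan F).obj Z) ((ofCospan F).obj W) := by
  simp only [tensorμ, Functor.map_comp, ofCospan_whiskerLeft, ofCospan_whiskerRight]
  rfl

open HypergraphCategory

/-- The hypergraph structure on `FCospan` is the image of that of `Cospan(C)`. -/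
instance : HypergraphCategory (DecoratedCospanCat F) where
  frob X := mapFrobenius (frob (CospanCat.of X.as))
  mul_tensor X Y := by
    have h := congrArg (ofCospan F).map (mul_tensor (CospanCat.of X.as) (CospanCat.of Y.as))
    simp only [Functor.map_comp, ofCospan_tensorHom, ofCospan_tensorμ] at h
    exact h
  one_tensor X Y := by
    have h := congrArg (ofCospan F).map (one_tensor (CospanCat.of X.as) (CospanCat.of Y.as))
    simp only [Functor.map_comp, ofCospan_tensorHom] at h
    exact h
  comul_tensor X Y := by
    have h := congrArg (ofCospan F).map (comul_tensor (CospanCat.of X.as) (CospanCat.of Y.as))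
    simp only [Functor.map_comp, ofCospan_tensorHom, ofCospan_tensorμ] at h
    exact h
  counit_tensor X Y := by
    have h := congrArg (ofCospan F).map (counit_tensor (CospanCat.of X.as) (CospanCat.of Y.as))
    simp only [Functor.map_comp, ofCospan_tensorHom] at h
    exact h

/-! ### `ofCospan` as a strict monoidal hypergraph functor -/

/-- Adding empty decorations is a strict monoidal functor. -/
instance : (ofCospan F).Monoidal :=
  Functor.CoreMonoidal.toMonoidal
    { εIso := Iso.refl _
      -- Source and target agree by definition, so each coherence condition reduces to removing
      -- identities.
      μIso := fun _ _ => Iso.refl _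
      μIso_hom_natural_left := fun f Z =>
        (Category.comp_id _).trans ((ofCospan_whiskerRight f Z).symm.trans (Category.id_comp _).symm)
      μIso_hom_natural_right := fun X f =>
        (Category.comp_id _).trans ((ofCospan_whiskerLeft X f).symm.trans (Category.id_comp _).symm)
      associativity := fun X Y Z =>
        ((congrArg (· ≫ 𝟙 _ ≫ (ofCospan F).map (α_ X Y Z).hom)
          (id_whiskerRight ((ofCospan F).obj (X ⊗ Y)) ((ofCospan F).obj Z))).trans
          ((Category.id_comp _).trans (Category.id_comp _))).trans
        ((congrArg (fun g => (α_ ((ofCospan F).obj X) ((ofCospan F).obj Y)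
          ((ofCospan F).obj Z)).hom ≫ g) ((congrArg (· ≫ _) (whiskerLeft_id _ _)).trans
          (Category.id_comp _))).trans (Category.comp_id _)).symm
      left_unitality := fun X => ((congrArg (· ≫ 𝟙 _ ≫ (ofCospan F).map (λ_ X).hom)
        (id_whiskerRight (𝟙_ (DecoratedCospanCat F)) ((ofCospan F).obj X))).trans
        ((Category.id_comp _).trans (Category.id_comp _))).symm
      right_unitality := fun X => ((congrArg (· ≫ 𝟙 _ ≫ (ofCospan F).map (ρ_ X).hom)
        (whiskerLeft_id ((ofCospan F).obj X) (𝟙_ (DecoratedCospanCat F)))).trans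
        ((Category.id_comp _).trans (Category.id_comp _))).symm }

instance : (ofCospan F).Braided where
  braided _ _ := (Category.id_comp _).trans (Category.comp_id _).symm

variable (F)

lemma ofCospan_isHypergraphFunctor : IsHypergraphFunctor (ofCospan F) where
  map_mul _ := (Category.id_comp _).symm
  map_comul _ := (Category.comp_id _).symm
  map_one _ := (Category.id_comp _).symm
  map_counit _ := (Category.comp_id _).symm

end DecoratedCospanCat

end

/-- Since the monoidal structure is existentially quantified, `of X ⊗ of X'` is not definitionally
`of (X ⨿ X')`. The last clause is therefore stated through `μ`, which the strictness clauses
identify with an `eqToHom`. -/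
theorem theorem3p3 {C : Type u₁} [Category.{v₁} C] [HasFiniteColimits C]
    {D : Type u₂} [Category.{v₂} D] [MonoidalCategory D] [BraidedCategory D]
    (F : C ⥤ D) [F.LaxBraided] :
    ∃ (_ : MonoidalCategory (DecoratedCospanCat F))
      (_ : SymmetricCategory (DecoratedCospanCat F))
      (_ : HypergraphCategory (DecoratedCospanCat F))
      (_ : (DecoratedCospanCat.ofCospan F).Braided),
      -- the functor adding empty decorations is a wide embedding of hypergraph categories
      IsHypergraphFunctor (DecoratedCospanCat.ofCospan F) ∧
      IsWideEmbedding (DecoratedCospanCat.ofCospan F) ∧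
      -- it is strict monoidal; in particular the monoidal product of objects is the coproduct in
      -- `C`, and the unitors, the associator and the braiding have empty decorations
      (∃ h : 𝟙_ (DecoratedCospanCat F) = (DecoratedCospanCat.ofCospan F).obj (𝟙_ (CospanCat C)),
        Functor.LaxMonoidal.ε (DecoratedCospanCat.ofCospan F) = eqToHom h) ∧
      (∃ h : ∀ X Y : CospanCat C,
          (DecoratedCospanCat.ofCospan F).obj X ⊗ (DecoratedCospanCat.ofCospan F).obj Y =
            (DecoratedCospanCat.ofCospan F).obj (X ⊗ Y),
        ∀ X Y : CospanCat C,
          Functor.LaxMonoidal.μ (DecoratedCospanCat.ofCospan F) X Y = eqToHom (h X Y)) ∧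
      -- the monoidal product of morphisms is the coproduct of cospans with the product decoration
      (∀ {X Y X' Y' : C} (a : DecoratedCospan F X Y) (b : DecoratedCospan F X' Y'),
        (DecoratedCospanCat.mk a ⊗ₘ DecoratedCospanCat.mk b) ≫
            Functor.LaxMonoidal.μ (DecoratedCospanCat.ofCospan F)
              (CospanCat.of Y) (CospanCat.of Y') =
          Functor.LaxMonoidal.μ (DecoratedCospanCat.ofCospan F)
              (CospanCat.of X) (CospanCat.of X') ≫
            DecoratedCospanCat.mk (a.sum b)) := by
  exact ⟨inferInstance, inferInstance, inferInstance, inferInstance,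
    DecoratedCospanCat.ofCospan_isHypergraphFunctor F,
    DecoratedCospanCat.ofCospan_isWideEmbedding F, ⟨rfl, rfl⟩, ⟨fun _ _ => rfl, fun _ _ => rfl⟩,
    fun a b => (Category.comp_id _).trans (Category.id_comp _).symm⟩
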